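/- A nonstandard extension of a pair of nonempty sets $(M,N)$ (a two-sorted structure) consists of nonempty sets ${}^*M,{}^*N$ and a mapping assigning to every $A\subseteq M^m\times N^n$ ($m,n\ge 0$) a set ${}^*A\subseteq({}^*M)^m\times({}^*N)^n$, with ${}^*(M^m\times N^n)=({}^*M)^m\times({}^*N)^n$, that preserves unions, intersections and set differences, the diagonals $\{x_i=x_j\}$ (for two coordinates of the same sort), Cartesian products, and projections omitting the last coordinate of either sort. Each function $f$ and each relation on $M,N$ then extends to ${}^*M,{}^*N$: the extension of $f$ is the function whose graph is the set assigned to the graph of $f$. The extension of $f$ is again denoted $f$. Let $K=\overline{\mathbb Q}$, and let $h:K\to\mathbb R$ be the absolute logarithmic height, $h(\alpha)=\frac1{[F:\mathbb Q]}\log\prod_{v\in M_F}\max\{1,\|\alpha\|_v\}$, where $F=\mathbb Q(\alpha)$, $M_F$ is the set of places of $F$ and $\|\cdot\|_v=|\cdot|_v^{[F_v:\mathbb Q_v]}$ are the usual normalized absolute values satisfying the product formula. Let $({}^*K,{}^*\mathbb R)$ be any nonstandard extension of $(K,\mathbb R)$, so that ${}^*K$ is a field under the extended operations and $h$ extends to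 $h:{}^*K\to{}^*\mathbb R$. Put ${\mathbb R}_{fin}=\{y\in{}^*\mathbb R : |y|<n \text{ for some } n\in\mathbb N\}$ and $$L=\{x\in{}^*K : h(x)\in{\mathbb R}_{fin}\}.$$ **Lemma 3.4.** $L$ is a subfield of ${}^*K$, and $L$ is an algebraically closed field. -/

import Mathlib

/-!
# Nonstandard extensions of two-sorted structures and elements of finite height
-/

universe u v w

/-- A nonstandard extension of a pair of base sets `(M, N)` (a two-sorted structure): nonempty sets
`*M = Fst` and `*N = Snd` and a mapping that assigns to every subset `A` of `M ^ m × N ^ n`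
(for all `m, n ≥ 0`) a subset `*A` of `(*M) ^ m × (*N) ^ n`, such that Boolean operations, basic
diagonals, Cartesian products and projections omitting the final coordinate (of either sort) are
preserved. Every function and relation on `M, N` thereby extends to `*M, *N`. -/
structure NonstandardExtension (M : Type u) (N : Type v) where
  /-- the set `*M` -/
  Fst : Type w
  /-- the set `*N` -/
  Snd : Type w
  nonempty_fst : Nonempty Fst
  nonempty_snd : Nonempty Snd
  /-- the mapping `A ↦ *A` -/
  star : ∀ {m n : ℕ}, Set ((Fin m → M) × (Fin n → N)) → Set ((Fin m → Fst) × (Fin n → Snd))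
  /-- `*M` and `*N` are the sets assigned to `M` and `N` -/
  star_univ : ∀ m n : ℕ,
    star (Set.univ : Set ((Fin m → M) × (Fin n → N))) = Set.univ
  star_union : ∀ {m n : ℕ} (A B : Set ((Fin m → M) × (Fin n → N))),
    star (A ∪ B) = star A ∪ star B
  star_inter : ∀ {m n : ℕ} (A B : Set ((Fin m → M) × (Fin n → N))),
    star (A ∩ B) = star A ∩ star B
  star_diff : ∀ {m n : ℕ} (A B : Set ((Fin m → M) × (Fin n → N))),
    star (A \ B) = star A \ star B
  star_diag_fst : ∀ {m n : ℕ} (i j : Fin m), i < j →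
    star {p : (Fin m → M) × (Fin n → N) | p.1 i = p.1 j} = {p | p.1 i = p.1 j}
  star_diag_snd : ∀ {m n : ℕ} (i j : Fin n), i < j →
    star {p : (Fin m → M) × (Fin n → N) | p.2 i = p.2 j} = {p | p.2 i = p.2 j}
  star_prod : ∀ {m n m' n' : ℕ} (A : Set ((Fin m → M) × (Fin n → N)))
    (B : Set ((Fin m' → M) × (Fin n' → N))),
    star {p : (Fin (m + m') → M) × (Fin (n + n') → N) |
        (p.1 ∘ Fin.castAdd m', p.2 ∘ Fin.castAdd n') ∈ A ∧
        (p.1 ∘ Fin.natAdd m, p.2 ∘ Fin.natAdd n) ∈ B} =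
      {p | (p.1 ∘ Fin.castAdd m', p.2 ∘ Fin.castAdd n') ∈ star A ∧
        (p.1 ∘ Fin.natAdd m, p.2 ∘ Fin.natAdd n) ∈ star B}
  star_proj_fst : ∀ {m n : ℕ} (A : Set ((Fin (m + 1) → M) × (Fin n → N))),
    star ((fun p => (p.1 ∘ Fin.castSucc, p.2)) '' A) =
      (fun p => (p.1 ∘ Fin.castSucc, p.2)) '' star A
  star_proj_snd : ∀ {m n : ℕ} (A : Set ((Fin m → M) × (Fin (n + 1) → N))),
    star ((fun p => (p.1, p.2 ∘ Fin.castSucc)) '' A) =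
      (fun p => (p.1, p.2 ∘ Fin.castSucc)) '' star A

namespace NonstandardExtension

variable {M : Type u} {N : Type v} (E : NonstandardExtension.{u, v, w} M N)

/-- The same extension with the two sorts exchanged. -/
def swap : NonstandardExtension.{v, u, w} N M where
  Fst := E.Snd
  Snd := E.Fst
  nonempty_fst := E.nonempty_snd
  nonempty_snd := E.nonempty_fst
  star A := Prod.swap ⁻¹' E.star (Prod.swap ⁻¹' A)
  star_univ m n := by rw [Set.preimage_univ, E.star_univ, Set.preimage_univ]
  star_union A B := by rw [Set.preimage_union, E.star_union, Set.preimage_union]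
  star_inter A B := by rw [Set.preimage_inter, E.star_inter, Set.preimage_inter]
  star_diff A B := by rw [Set.preimage_sdiff, E.star_diff, Set.preimage_sdiff]
  star_diag_fst i j h := by
    exact congrArg (Prod.swap ⁻¹' ·) (E.star_diag_snd i j h)
  star_diag_snd i j h := by
    exact congrArg (Prod.swap ⁻¹' ·) (E.star_diag_fst i j h)
  star_prod A B := congrArg (Prod.swap ⁻¹' ·)
    (E.star_prod (Prod.swap ⁻¹' A) (Prod.swap ⁻¹' B))
  star_proj_fst A := by
    have := congrArg (Prod.swap ⁻¹' ·) (E.star_proj_snd (Prod.swap ⁻¹' A))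
    simp only [← Set.image_swap_eq_preimage_swap, Set.image_image] at this ⊢
    exact this
  star_proj_snd A := by
    have := congrArg (Prod.swap ⁻¹' ·) (E.star_proj_fst (Prod.swap ⁻¹' A))
    simp only [← Set.image_swap_eq_preimage_swap, Set.image_image] at this ⊢
    exact this

theorem star_mono {m n : ℕ} {A B : Set ((Fin m → M) × (Fin n → N))} (h : A ⊆ B) :
    E.star A ⊆ E.star B := by
  rw [← Set.union_eq_self_of_subset_left h, E.star_union]
  exact Set.subset_union_left

theorem star_iInter {m n k : ℕ} (A : Fin k → Set ((Fin m → M) × (Fin n → N))) :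
    E.star (⋂ i, A i) = ⋂ i, E.star (A i) := by
  induction k with
  | zero => simp [E.star_univ]
  | succ k ih =>
    have h1 : (⋂ i, A i) = A 0 ∩ ⋂ i : Fin k, A i.succ := by
      ext x; simp [Fin.forall_fin_succ]
    have h2 : (⋂ i, E.star (A i)) = E.star (A 0) ∩ ⋂ i : Fin k, E.star (A i.succ) := by
      ext x; simp [Fin.forall_fin_succ]
    rw [h1, h2, E.star_inter, ih]

theorem exists_append_zero {α β : Type*} {m n : ℕ} (A : Set ((Fin (m + 0) → α) × (Fin n → β))) :
    {p : (Fin m → α) × (Fin n → β) | ∃ y : Fin 0 → α, (Fin.append p.1 y, p.2) ∈ A} = A := by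
  have h : ∀ (x : Fin m → α) (y : Fin 0 → α), Fin.append x y = x := by
    intro x y
    rw [Subsingleton.elim y Fin.elim0, Fin.append_elim0]
    rfl
  ext p
  exact ⟨fun ⟨y, hy⟩ => by rwa [h] at hy, fun hp => ⟨Fin.elim0, by rwa [h]⟩⟩

theorem exists_append_succ {α β : Type*} {m n k : ℕ}
    (A : Set ((Fin (m + k + 1) → α) × (Fin n → β))) :
    {p : (Fin m → α) × (Fin n → β) | ∃ y : Fin (k + 1) → α,
        ((Fin.append p.1 y : Fin (m + (k + 1)) → α), p.2) ∈ A} =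
      {p | ∃ y : Fin k → α, (Fin.append p.1 y, p.2) ∈
        (fun q : (Fin (m + k + 1) → α) × (Fin n → β) => (q.1 ∘ Fin.castSucc, q.2)) '' A} := by
  have key : ∀ (x : Fin m → α) (y : Fin (k + 1) → α),
      (Fin.append x y : Fin (m + (k + 1)) → α) ∘ (Fin.castSucc : Fin (m + k) → Fin (m + k + 1)) =
        Fin.append x (y ∘ Fin.castSucc) := by
    intro x y
    funext i
    induction i using Fin.addCases with
    | left i => exact (Fin.append_left x y i).trans (Fin.append_left x _ i).symm
    | right i => exact (Fin.append_right x y i.castSucc).trans (Fin.append_right x (y ∘ Fin.castSucc) i).symm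
  ext p
  constructor
  · rintro ⟨y, hy⟩
    exact ⟨y ∘ Fin.castSucc, _, hy, Prod.ext (key p.1 y) rfl⟩
  · rintro ⟨y, q, hq, h⟩
    refine ⟨Fin.snoc (α := fun _ => α) y (q.1 (Fin.last _)), ?_⟩
    have h1 : q.1 ∘ Fin.castSucc = Fin.append p.1 y := congrArg Prod.fst h
    have h2 : q.2 = p.2 := congrArg Prod.snd h
    have : ((Fin.append p.1 (Fin.snoc (α := fun _ => α) y (q.1 (Fin.last _))) :
        Fin (m + (k + 1)) → α), p.2) = q := by
      refine Prod.ext ?_ h2.symm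
      rw [Fin.append_snoc, ← h1]
      exact Fin.snoc_init_self (α := fun _ => α) q.1
    rwa [this]

theorem star_exists_fst {m n : ℕ} (k : ℕ) (A : Set ((Fin (m + k) → M) × (Fin n → N))) :
    E.star {p : (Fin m → M) × (Fin n → N) | ∃ y : Fin k → M, (Fin.append p.1 y, p.2) ∈ A} =
      {p | ∃ y : Fin k → E.Fst, (Fin.append p.1 y, p.2) ∈ E.star A} := by
  induction k with
  | zero => rw [exists_append_zero, exists_append_zero]
  | succ k ih =>
    have h := ih ((fun q : (Fin (m + k + 1) → M) × (Fin n → N) => (q.1 ∘ Fin.castSucc, q.2)) '' A)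
    have h2 := E.star_proj_fst (m := m + k) A
    rw [h2] at h
    exact (congrArg E.star (exists_append_succ A)).trans
      (h.trans (exists_append_succ (E.star A)).symm)

theorem star_exists_snd {m n : ℕ} (k : ℕ) (A : Set ((Fin m → M) × (Fin (n + k) → N))) :
    E.star {p : (Fin m → M) × (Fin n → N) | ∃ y : Fin k → N, (p.1, Fin.append p.2 y) ∈ A} =
      {p | ∃ y : Fin k → E.Snd, (p.1, Fin.append p.2 y) ∈ E.star A} :=
  congrArg (Prod.swap ⁻¹' ·) (E.swap.star_exists_fst k (Prod.swap ⁻¹' A))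

theorem star_exists {m n : ℕ} (k l : ℕ) (A : Set ((Fin (m + k) → M) × (Fin (n + l) → N))) :
    E.star {p : (Fin m → M) × (Fin n → N) | ∃ (y : Fin k → M) (z : Fin l → N),
        (Fin.append p.1 y, Fin.append p.2 z) ∈ A} =
      {p | ∃ (y : Fin k → E.Fst) (z : Fin l → E.Snd),
        (Fin.append p.1 y, Fin.append p.2 z) ∈ E.star A} := by
  have h := E.star_exists_fst (m := m) k
    {p : (Fin (m + k) → M) × (Fin n → N) | ∃ z : Fin l → N, (p.1, Fin.append p.2 z) ∈ A}
  rw [E.star_exists_snd l A] at h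
  exact h

theorem star_eq_fst {m n : ℕ} (i j : Fin m) :
    E.star {p : (Fin m → M) × (Fin n → N) | p.1 i = p.1 j} = {p | p.1 i = p.1 j} := by
  rcases lt_trichotomy i j with h | rfl | h
  · exact E.star_diag_fst i j h
  · simpa using! E.star_univ m n
  · simpa only [eq_comm] using E.star_diag_fst (n := n) j i h

theorem star_eq_snd {m n : ℕ} (i j : Fin n) :
    E.star {p : (Fin m → M) × (Fin n → N) | p.2 i = p.2 j} = {p | p.2 i = p.2 j} :=
  congrArg (Prod.swap ⁻¹' ·) (E.swap.star_eq_fst (n := m) i j)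

theorem star_forall {m n k : ℕ} (p : Fin k → (Fin m → M) × (Fin n → N) → Prop) :
    E.star {x | ∀ i, p i x} = {x | ∀ i, x ∈ E.star {x | p i x}} := by
  have := E.star_iInter (fun i => {x | p i x})
  ext x
  have h := congrArg (x ∈ ·) this
  simpa [Set.mem_iInter, Set.ofPred_forall] using h

theorem star_and {m n : ℕ} (p q : (Fin m → M) × (Fin n → N) → Prop) :
    E.star {x | p x ∧ q x} = {x | x ∈ E.star {x | p x} ∧ x ∈ E.star {x | q x}} :=
  E.star_inter {x | p x} {x | q x}

theorem star_right {m n k l : ℕ} (A : Set ((Fin k → M) × (Fin l → N))) :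
    E.star {p : (Fin (m + k) → M) × (Fin (n + l) → N) |
        (p.1 ∘ Fin.natAdd m, p.2 ∘ Fin.natAdd n) ∈ A} =
      {p | (p.1 ∘ Fin.natAdd m, p.2 ∘ Fin.natAdd n) ∈ E.star A} := by
  simpa [E.star_univ] using E.star_prod (m := m) (n := n) Set.univ A

theorem star_left {m n k l : ℕ} (A : Set ((Fin m → M) × (Fin n → N))) :
    E.star {p : (Fin (m + k) → M) × (Fin (n + l) → N) |
        (p.1 ∘ Fin.castAdd k, p.2 ∘ Fin.castAdd l) ∈ A} =
      {p | (p.1 ∘ Fin.castAdd k, p.2 ∘ Fin.castAdd l) ∈ E.star A} := by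
  simpa [E.star_univ] using E.star_prod (m' := k) (n' := l) A Set.univ

theorem append_comp_castAdd {α : Type*} {m k : ℕ} (x : Fin m → α) (y : Fin k → α) :
    Fin.append x y ∘ Fin.castAdd k = x := funext fun i => Fin.append_left x y i

theorem append_comp_natAdd {α : Type*} {m k : ℕ} (x : Fin m → α) (y : Fin k → α) :
    Fin.append x y ∘ Fin.natAdd m = y := funext fun i => Fin.append_right x y i

theorem reindex_eq {α β : Type*} {m n k l : ℕ} (s : Fin k → Fin m) (t : Fin l → Fin n)
    (A : Set ((Fin k → α) × (Fin l → β))) :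
    {p : (Fin m → α) × (Fin n → β) | (p.1 ∘ s, p.2 ∘ t) ∈ A} =
      {p | ∃ (y : Fin k → α) (z : Fin l → β), (Fin.append p.1 y, Fin.append p.2 z) ∈
        {q : (Fin (m + k) → α) × (Fin (n + l) → β) |
          (q.1 ∘ Fin.natAdd m, q.2 ∘ Fin.natAdd n) ∈ A ∧
          (∀ i, q.1 (Fin.natAdd m i) = q.1 (Fin.castAdd k (s i))) ∧
          ∀ j, q.2 (Fin.natAdd n j) = q.2 (Fin.castAdd l (t j))}} := by
  ext p
  simp only [Set.mem_ofPred_eq, append_comp_natAdd, Fin.append_right, Fin.append_left]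
  constructor
  · exact fun h => ⟨_, _, h, fun _ => rfl, fun _ => rfl⟩
  · rintro ⟨y, z, h, hy, hz⟩
    obtain rfl : y = p.1 ∘ s := funext hy
    obtain rfl : z = p.2 ∘ t := funext hz
    exact h

/-- The mapping `A ↦ *A` commutes with permuting, repeating and omitting coordinates. -/
theorem star_reindex {m n k l : ℕ} (s : Fin k → Fin m) (t : Fin l → Fin n)
    (A : Set ((Fin k → M) × (Fin l → N))) :
    E.star {p : (Fin m → M) × (Fin n → N) | (p.1 ∘ s, p.2 ∘ t) ∈ A} =
      {p | (p.1 ∘ s, p.2 ∘ t) ∈ E.star A} := by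
  rw [reindex_eq, E.star_exists, reindex_eq, E.star_and, E.star_and, E.star_forall, E.star_forall,
    E.star_right]
  simp only [E.star_eq_fst, E.star_eq_snd]
  rfl

/-- The graph of a function `M ^ m × N ^ n → M`. -/
def graphFst {m n : ℕ} (f : (Fin m → M) × (Fin n → N) → M) :
    Set ((Fin (m + 1) → M) × (Fin n → N)) :=
  {q | q.1 (Fin.last m) = f (q.1 ∘ Fin.castSucc, q.2)}

/-- The graph of a function `M ^ m × N ^ n → N`. -/
def graphSnd {m n : ℕ} (f : (Fin m → M) × (Fin n → N) → N) :
    Set ((Fin m → M) × (Fin (n + 1) → N)) :=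
  {q | q.2 (Fin.last n) = f (q.1, q.2 ∘ Fin.castSucc)}

theorem snoc_comp {α : Type*} {m : ℕ} (x : Fin m → α) (y : α) :
    (Fin.snoc x y : Fin (m + 1) → α) ∘ Fin.castSucc = x :=
  funext fun i => Fin.snoc_castSucc (α := fun _ => α) y x i

theorem existsUnique_starFst {m n : ℕ} (f : (Fin m → M) × (Fin n → N) → M)
    (a : (Fin m → E.Fst) × (Fin n → E.Snd)) :
    ∃! y : E.Fst, ((Fin.snoc a.1 y : Fin (m + 1) → E.Fst), a.2) ∈ E.star (graphFst f) := by
  apply existsUnique_of_exists_of_unique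
  · have h : (fun p : (Fin (m + 1) → M) × (Fin n → N) => (p.1 ∘ Fin.castSucc, p.2)) ''
        graphFst f = Set.univ := by
      refine Set.eq_univ_of_forall fun p => ⟨(Fin.snoc p.1 (f p), p.2), ?_, ?_⟩
      · simp [graphFst]
      · simp
    have h2 := E.star_proj_fst (graphFst f)
    rw [h, E.star_univ] at h2
    obtain ⟨q, hq, hqa⟩ : a ∈ (fun p : (Fin (m + 1) → E.Fst) × (Fin n → E.Snd) =>
      (p.1 ∘ Fin.castSucc, p.2)) '' E.star (graphFst f) := h2 ▸ Set.mem_univ a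
    refine ⟨q.1 (Fin.last m), ?_⟩
    subst hqa
    have : (Fin.snoc (q.1 ∘ Fin.castSucc) (q.1 (Fin.last m)) : Fin (m + 1) → E.Fst) = q.1 :=
      Fin.snoc_init_self (α := fun _ => E.Fst) q.1
    rw [this]
    exact hq
  · intro y z hy hz
    have h : {p : (Fin (m + 2) → M) × (Fin n → N) |
          (p.1 ∘ Fin.castSucc, p.2 ∘ id) ∈ graphFst f ∧
          (p.1 ∘ (Fin.snoc (Fin.castSucc ∘ Fin.castSucc) (Fin.last (m + 1)) :
            Fin (m + 1) → Fin (m + 2)), p.2 ∘ id) ∈ graphFst f} ⊆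
        {p | p.1 (Fin.last m).castSucc = p.1 (Fin.last (m + 1))} := by
      rintro p ⟨h1, h2⟩
      simp only [graphFst, Set.mem_ofPred_eq, Function.comp_apply, Fin.snoc_last,
        Function.comp_assoc, snoc_comp] at h1 h2
      exact h1.trans h2.symm
    have h' := E.star_mono h
    rw [E.star_and, E.star_eq_fst, E.star_reindex, E.star_reindex] at h'
    have h3 := @h' ((Fin.snoc (Fin.snoc a.1 y : Fin (m + 1) → E.Fst) z : Fin (m + 2) → E.Fst), a.2)
    simp only [Set.mem_ofPred_eq, snoc_comp, Function.comp_id, Fin.snoc_castSucc,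
      Fin.snoc_last] at h3
    refine h3 ⟨hy, ?_⟩
    convert hz using 2
    funext i
    induction i using Fin.lastCases with
    | last => simp
    | cast i => simp

/-- The extension `*f : (*M) ^ m × (*N) ^ n → *M` of a function `f : M ^ m × N ^ n → M`: the
function whose graph is `*(graph f)`. -/
noncomputable def starFst {m n : ℕ} (f : (Fin m → M) × (Fin n → N) → M)
    (a : (Fin m → E.Fst) × (Fin n → E.Snd)) : E.Fst :=
  (E.existsUnique_starFst f a).choose

theorem starFst_eq_iff {m n : ℕ} (f : (Fin m → M) × (Fin n → N) → M)
    (a : (Fin m → E.Fst) × (Fin n → E.Snd)) (y : E.Fst) :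
    E.starFst f a = y ↔ ((Fin.snoc a.1 y : Fin (m + 1) → E.Fst), a.2) ∈ E.star (graphFst f) := by
  have h := (E.existsUnique_starFst f a).choose_spec
  exact ⟨fun hy => hy ▸ h.1, fun hy => (h.2 y hy).symm⟩

theorem existsUnique_starSnd {m n : ℕ} (f : (Fin m → M) × (Fin n → N) → N)
    (a : (Fin m → E.Fst) × (Fin n → E.Snd)) :
    ∃! y : E.Snd, (a.1, (Fin.snoc a.2 y : Fin (n + 1) → E.Snd)) ∈ E.star (graphSnd f) :=
  E.swap.existsUnique_starFst (fun p => f p.swap) a.swap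

/-- The extension `*f : (*M) ^ m × (*N) ^ n → *N` of a function `f : M ^ m × N ^ n → N`: the
function whose graph is `*(graph f)`. -/
noncomputable def starSnd {m n : ℕ} (f : (Fin m → M) × (Fin n → N) → N)
    (a : (Fin m → E.Fst) × (Fin n → E.Snd)) : E.Snd :=
  (E.existsUnique_starSnd f a).choose

theorem starSnd_eq_iff {m n : ℕ} (f : (Fin m → M) × (Fin n → N) → N)
    (a : (Fin m → E.Fst) × (Fin n → E.Snd)) (y : E.Snd) :
    E.starSnd f a = y ↔ (a.1, (Fin.snoc a.2 y : Fin (n + 1) → E.Snd)) ∈ E.star (graphSnd f) := by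
  have h := (E.existsUnique_starSnd f a).choose_spec
  exact ⟨fun hy => hy ▸ h.1, fun hy => (h.2 y hy).symm⟩

theorem comp_eq {α β : Type*} {m n k l : ℕ} (f : Fin k → (Fin m → α) × (Fin n → β) → α)
    (g : Fin l → (Fin m → α) × (Fin n → β) → β) (A : Set ((Fin k → α) × (Fin l → β))) :
    {p : (Fin m → α) × (Fin n → β) | (fun i => f i p, fun j => g j p) ∈ A} =
      {p | ∃ (y : Fin k → α) (z : Fin l → β), (Fin.append p.1 y, Fin.append p.2 z) ∈
        {q : (Fin (m + k) → α) × (Fin (n + l) → β) |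
          (q.1 ∘ Fin.natAdd m, q.2 ∘ Fin.natAdd n) ∈ A ∧
          (∀ i, f i (q.1 ∘ Fin.castAdd k, q.2 ∘ Fin.castAdd l) = q.1 (Fin.natAdd m i)) ∧
          ∀ j, g j (q.1 ∘ Fin.castAdd k, q.2 ∘ Fin.castAdd l) = q.2 (Fin.natAdd n j)}} := by
  ext p
  simp only [Set.mem_ofPred_eq, append_comp_natAdd, append_comp_castAdd, Fin.append_right]
  constructor
  · exact fun h => ⟨_, _, h, fun _ => rfl, fun _ => rfl⟩
  · rintro ⟨y, z, h, hy, hz⟩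
    obtain rfl : (fun i => f i p) = y := funext hy
    obtain rfl : (fun j => g j p) = z := funext hz
    exact h

theorem comp_snoc {α γ : Type*} {k : ℕ} (x : γ → α) (s : Fin k → γ) (c : γ) :
    x ∘ (Fin.snoc s c : Fin (k + 1) → γ) = Fin.snoc (x ∘ s) (x c) :=
  Fin.comp_snoc x s c

theorem star_graph_fst {m n k l : ℕ} (f : (Fin m → M) × (Fin n → N) → M) (i : Fin k) :
    E.star {q : (Fin (m + k) → M) × (Fin (n + l) → N) |
        f (q.1 ∘ Fin.castAdd k, q.2 ∘ Fin.castAdd l) = q.1 (Fin.natAdd m i)} =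
      {q | E.starFst f (q.1 ∘ Fin.castAdd k, q.2 ∘ Fin.castAdd l) = q.1 (Fin.natAdd m i)} := by
  have h := E.star_reindex (Fin.snoc (Fin.castAdd k) (Fin.natAdd m i) : Fin (m + 1) → Fin (m + k))
    (Fin.castAdd l : Fin n → Fin (n + l)) (graphFst f)
  simp only [comp_snoc] at h
  simp only [starFst_eq_iff, ← h]
  simp [graphFst, eq_comm]

theorem star_graph_snd {m n k l : ℕ} (g : (Fin m → M) × (Fin n → N) → N) (j : Fin l) :
    E.star {q : (Fin (m + k) → M) × (Fin (n + l) → N) |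
        g (q.1 ∘ Fin.castAdd k, q.2 ∘ Fin.castAdd l) = q.2 (Fin.natAdd n j)} =
      {q | E.starSnd g (q.1 ∘ Fin.castAdd k, q.2 ∘ Fin.castAdd l) = q.2 (Fin.natAdd n j)} := by
  have h := E.star_reindex (Fin.castAdd k : Fin m → Fin (m + k))
    (Fin.snoc (Fin.castAdd l) (Fin.natAdd n j) : Fin (n + 1) → Fin (n + l)) (graphSnd g)
  simp only [comp_snoc] at h
  simp only [starSnd_eq_iff, ← h]
  simp [graphSnd, eq_comm]

/-- Transfer for substitution of functions into a relation. -/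
theorem star_comp {m n k l : ℕ} (f : Fin k → (Fin m → M) × (Fin n → N) → M)
    (g : Fin l → (Fin m → M) × (Fin n → N) → N) (A : Set ((Fin k → M) × (Fin l → N))) :
    E.star {p | (fun i => f i p, fun j => g j p) ∈ A} =
      {a | (fun i => E.starFst (f i) a, fun j => E.starSnd (g j) a) ∈ E.star A} := by
  rw [comp_eq, E.star_exists, comp_eq, E.star_and, E.star_and, E.star_forall, E.star_forall,
    E.star_right]
  simp only [E.star_graph_fst, E.star_graph_snd]
  rfl

/-- Extension of functions commutes with composition. -/
theorem starFst_comp {m n k l : ℕ} (F : (Fin k → M) × (Fin l → N) → M)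
    (f : Fin k → (Fin m → M) × (Fin n → N) → M) (g : Fin l → (Fin m → M) × (Fin n → N) → N)
    (a : (Fin m → E.Fst) × (Fin n → E.Snd)) :
    E.starFst (fun p => F (fun i => f i p, fun j => g j p)) a =
      E.starFst F (fun i => E.starFst (f i) a, fun j => E.starSnd (g j) a) := by
  symm
  rw [starFst_eq_iff]
  have h := E.star_comp (Fin.snoc f (fun p => F (fun i => f i p, fun j => g j p)) :
    Fin (k + 1) → (Fin m → M) × (Fin n → N) → M) g (graphFst F)
  have h1 : {p | (fun i => (Fin.snoc f (fun p => F (fun i => f i p, fun j => g j p)) :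
    Fin (k + 1) → (Fin m → M) × (Fin n → N) → M) i p, fun j => g j p) ∈ graphFst F} =
      Set.univ := by
    refine Set.eq_univ_of_forall fun p => ?_
    simp [graphFst, Function.comp_def]
  rw [h1, E.star_univ] at h
  have h2 : a ∈ _ := h ▸ Set.mem_univ a
  rw [Set.mem_ofPred_eq] at h2
  convert h2 using 2
  funext i
  induction i using Fin.lastCases with
  | last => simp
  | cast i => simp

/-- Extension of functions commutes with composition. -/
theorem starSnd_comp {m n k l : ℕ} (F : (Fin k → M) × (Fin l → N) → N)
    (f : Fin k → (Fin m → M) × (Fin n → N) → M) (g : Fin l → (Fin m → M) × (Fin n → N) → N)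
    (a : (Fin m → E.Fst) × (Fin n → E.Snd)) :
    E.starSnd (fun p => F (fun i => f i p, fun j => g j p)) a =
      E.starSnd F (fun i => E.starFst (f i) a, fun j => E.starSnd (g j) a) :=
  E.swap.starFst_comp (fun p => F p.swap) (fun j p => g j p.swap) (fun i p => f i p.swap) a.swap

theorem starFst_proj {m n : ℕ} (i : Fin m) (a : (Fin m → E.Fst) × (Fin n → E.Snd)) :
    E.starFst (fun p => p.1 i) a = a.1 i := by
  rw [starFst_eq_iff]
  have h := E.star_eq_fst (n := n) (Fin.last m) i.castSucc
  have h' : graphFst (fun p : (Fin m → M) × (Fin n → N) => p.1 i) =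
    {p | p.1 (Fin.last m) = p.1 i.castSucc} := rfl
  rw [h', h]
  simp

theorem mem_star_eq_fst {m n : ℕ} (f g : (Fin m → M) × (Fin n → N) → M)
    (a : (Fin m → E.Fst) × (Fin n → E.Snd)) :
    a ∈ E.star {p | f p = g p} ↔ E.starFst f a = E.starFst g a := by
  have h := E.star_comp ![f, g] (Fin.elim0 : Fin 0 → _) {p | p.1 0 = p.1 1}
  rw [E.star_eq_fst] at h
  exact iff_of_eq (congrArg (a ∈ ·) h)

theorem starFst_const {m n m' n' : ℕ} (c : M) (a : (Fin m → E.Fst) × (Fin n → E.Snd))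
    (b : (Fin m' → E.Fst) × (Fin n' → E.Snd)) :
    E.starFst (fun _ => c) a = E.starFst (fun _ => c) b := by
  have h : ∀ {m n : ℕ} (a : (Fin m → E.Fst) × (Fin n → E.Snd)), E.starFst (fun _ => c) a =
      E.starFst (fun _ : (Fin 0 → M) × (Fin 0 → N) => c) (Fin.elim0, Fin.elim0) := by
    intro m n a
    refine (E.starFst_comp (fun _ : (Fin 0 → M) × (Fin 0 → N) => c) (fun i => i.elim0)
      (fun i => i.elim0) a).trans ?_
    congr 2
    all_goals exact Subsingleton.elim _ _
  rw [h a, h b]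

/-- The canonical embedding of `M` into `*M`. -/
noncomputable def coeFst (c : M) : E.Fst :=
  E.starFst (fun _ : (Fin 0 → M) × (Fin 0 → N) => c) (Fin.elim0, Fin.elim0)

/-- The canonical embedding of `N` into `*N`. -/
noncomputable def coeSnd (c : N) : E.Snd :=
  E.starSnd (fun _ : (Fin 0 → M) × (Fin 0 → N) => c) (Fin.elim0, Fin.elim0)

/-- The extension `*M → *M` of a function `M → M`. -/
noncomputable def mapFst (f : M → M) (x : E.Fst) : E.Fst :=
  E.starFst (fun p : (Fin 1 → M) × (Fin 0 → N) => f (p.1 0)) (![x], ![])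

/-- The extension `*M × *M → *M` of a function `M × M → M`. -/
noncomputable def mapFst₂ (f : M → M → M) (x y : E.Fst) : E.Fst :=
  E.starFst (fun p : (Fin 2 → M) × (Fin 0 → N) => f (p.1 0) (p.1 1)) (![x, y], ![])

/-- The extension `*N → *N` of a function `N → N`. -/
noncomputable def mapSnd (f : N → N) (y : E.Snd) : E.Snd :=
  E.starSnd (fun p : (Fin 0 → M) × (Fin 1 → N) => f (p.2 0)) (![], ![y])

/-- The extension `*M → *N` of a function `M → N`. -/
noncomputable def mapFstSnd (f : M → N) (x : E.Fst) : E.Snd :=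
  E.starSnd (fun p : (Fin 1 → M) × (Fin 0 → N) => f (p.1 0)) (![x], ![])

/-- The extension to `*N` of a binary relation on `N`. -/
def relSnd (r : N → N → Prop) (x y : E.Snd) : Prop :=
  (![], ![x, y]) ∈ E.star {p : (Fin 0 → M) × (Fin 2 → N) | r (p.2 0) (p.2 1)}

section Transfer

variable {m n : ℕ} (a : (Fin m → E.Fst) × (Fin n → E.Snd))

theorem coeFst_eq (c : M) : E.coeFst c = E.starFst (fun _ => c) a := E.starFst_const c _ _

theorem mapFst_starFst (F : M → M) (f : (Fin m → M) × (Fin n → N) → M) :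
    E.mapFst F (E.starFst f a) = E.starFst (fun p => F (f p)) a := by
  refine Eq.trans ?_ (E.starFst_comp (fun p : (Fin 1 → M) × (Fin 0 → N) => F (p.1 0)) ![f] ![] a).symm
  rw [mapFst]
  congr 2
  · funext i; fin_cases i; rfl
  · exact Subsingleton.elim _ _

theorem mapFst₂_starFst (F : M → M → M) (f g : (Fin m → M) × (Fin n → N) → M) :
    E.mapFst₂ F (E.starFst f a) (E.starFst g a) = E.starFst (fun p => F (f p) (g p)) a := by
  refine Eq.trans ?_
    (E.starFst_comp (fun p : (Fin 2 → M) × (Fin 0 → N) => F (p.1 0) (p.1 1)) ![f, g] ![] a).symm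
  rw [mapFst₂]
  congr 2
  · funext i; fin_cases i <;> rfl
  · exact Subsingleton.elim _ _

end Transfer

theorem exists_rep (x y w : E.Fst) : ∃ a : (Fin 3 → E.Fst) × (Fin 0 → E.Snd),
    x = E.starFst (fun p => p.1 0) a ∧ y = E.starFst (fun p => p.1 1) a ∧
      w = E.starFst (fun p => p.1 2) a :=
  ⟨(![x, y, w], ![]), by rw [starFst_proj]; rfl, by rw [starFst_proj]; rfl,
    by rw [starFst_proj]; rfl⟩

noncomputable instance instZeroFst [Zero M] : Zero E.Fst := ⟨E.coeFst 0⟩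

noncomputable instance instOneFst [One M] : One E.Fst := ⟨E.coeFst 1⟩

noncomputable instance instAddFst [Add M] : Add E.Fst := ⟨E.mapFst₂ (· + ·)⟩

noncomputable instance instMulFst [Mul M] : Mul E.Fst := ⟨E.mapFst₂ (· * ·)⟩

noncomputable instance instNegFst [Neg M] : Neg E.Fst := ⟨E.mapFst (- ·)⟩

noncomputable instance instInvFst [Inv M] : Inv E.Fst := ⟨E.mapFst (·⁻¹)⟩

/-- If `M` is a field, then `*M` is a field under the extended operations. -/
noncomputable instance instFieldFst [Field M] : Field E.Fst where
  nsmul := nsmulRec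
  zsmul := zsmulRec
  nnqsmul := _
  nnqsmul_def := fun _ _ => rfl
  qsmul := _
  qsmul_def := fun _ _ => rfl
  add_assoc x y w := by
    obtain ⟨a, rfl, rfl, rfl⟩ := E.exists_rep x y w
    change E.mapFst₂ _ (E.mapFst₂ _ _ _) _ = E.mapFst₂ _ _ (E.mapFst₂ _ _ _)
    simp only [mapFst₂_starFst, add_assoc]
  zero_add x := by
    obtain ⟨a, rfl, -, -⟩ := E.exists_rep x x x
    change E.mapFst₂ _ (E.coeFst 0) _ = _
    simp only [E.coeFst_eq a, mapFst₂_starFst, zero_add]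
  add_zero x := by
    obtain ⟨a, rfl, -, -⟩ := E.exists_rep x x x
    change E.mapFst₂ _ _ (E.coeFst 0) = _
    simp only [E.coeFst_eq a, mapFst₂_starFst, add_zero]
  add_comm x y := by
    obtain ⟨a, rfl, rfl, -⟩ := E.exists_rep x y x
    change E.mapFst₂ _ _ _ = E.mapFst₂ _ _ _
    simp only [mapFst₂_starFst, add_comm]
  neg_add_cancel x := by
    obtain ⟨a, rfl, -, -⟩ := E.exists_rep x x x
    change E.mapFst₂ _ (E.mapFst _ _) _ = E.coeFst 0
    simp only [E.coeFst_eq a, mapFst₂_starFst, mapFst_starFst, neg_add_cancel]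
  mul_assoc x y w := by
    obtain ⟨a, rfl, rfl, rfl⟩ := E.exists_rep x y w
    change E.mapFst₂ _ (E.mapFst₂ _ _ _) _ = E.mapFst₂ _ _ (E.mapFst₂ _ _ _)
    simp only [mapFst₂_starFst, mul_assoc]
  mul_comm x y := by
    obtain ⟨a, rfl, rfl, -⟩ := E.exists_rep x y x
    change E.mapFst₂ _ _ _ = E.mapFst₂ _ _ _
    simp only [mapFst₂_starFst, mul_comm]
  one_mul x := by
    obtain ⟨a, rfl, -, -⟩ := E.exists_rep x x x
    change E.mapFst₂ _ (E.coeFst 1) _ = _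
    simp only [E.coeFst_eq a, mapFst₂_starFst, one_mul]
  mul_one x := by
    obtain ⟨a, rfl, -, -⟩ := E.exists_rep x x x
    change E.mapFst₂ _ _ (E.coeFst 1) = _
    simp only [E.coeFst_eq a, mapFst₂_starFst, mul_one]
  zero_mul x := by
    obtain ⟨a, rfl, -, -⟩ := E.exists_rep x x x
    change E.mapFst₂ _ (E.coeFst 0) _ = E.coeFst 0
    simp only [E.coeFst_eq a, mapFst₂_starFst, zero_mul]
  mul_zero x := by
    obtain ⟨a, rfl, -, -⟩ := E.exists_rep x x x
    change E.mapFst₂ _ _ (E.coeFst 0) = E.coeFst 0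
    simp only [E.coeFst_eq a, mapFst₂_starFst, mul_zero]
  left_distrib x y w := by
    obtain ⟨a, rfl, rfl, rfl⟩ := E.exists_rep x y w
    change E.mapFst₂ _ _ (E.mapFst₂ _ _ _) = E.mapFst₂ _ (E.mapFst₂ _ _ _) (E.mapFst₂ _ _ _)
    simp only [mapFst₂_starFst, mul_add]
  right_distrib x y w := by
    obtain ⟨a, rfl, rfl, rfl⟩ := E.exists_rep x y w
    change E.mapFst₂ _ (E.mapFst₂ _ _ _) _ = E.mapFst₂ _ (E.mapFst₂ _ _ _) (E.mapFst₂ _ _ _)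
    simp only [mapFst₂_starFst, add_mul]
  exists_pair_ne := by
    let a : (Fin 0 → E.Fst) × (Fin 0 → E.Snd) := (![], ![])
    refine ⟨E.coeFst 0, E.coeFst 1, ?_⟩
    rw [E.coeFst_eq a, E.coeFst_eq a, Ne, ← mem_star_eq_fst]
    have h : {p : (Fin 0 → M) × (Fin 0 → N) | (0 : M) = 1} = ∅ := by simp
    rw [h, ← Set.sdiff_self (s := Set.univ), E.star_diff]
    simp
  inv_zero := by
    let a : (Fin 0 → E.Fst) × (Fin 0 → E.Snd) := (![], ![])
    change E.mapFst _ (E.coeFst 0) = E.coeFst 0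
    simp only [E.coeFst_eq a, mapFst_starFst, inv_zero]
  mul_inv_cancel x hx := by
    obtain ⟨a, rfl, -, -⟩ := E.exists_rep x x x
    change E.mapFst₂ _ _ (E.mapFst _ _) = E.coeFst 1
    change E.starFst _ a ≠ E.coeFst 0 at hx
    simp only [E.coeFst_eq a, mapFst₂_starFst, mapFst_starFst] at hx ⊢
    rw [Ne, ← mem_star_eq_fst] at hx
    rw [← mem_star_eq_fst]
    have h : {p : (Fin 3 → M) × (Fin 0 → N) | p.1 0 = 0} ∪
        {p | p.1 0 * (p.1 0)⁻¹ = 1} = Set.univ := by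
      refine Set.eq_univ_of_forall fun p => ?_
      by_cases h0 : p.1 0 = 0
      · exact Or.inl h0
      · exact Or.inr (mul_inv_cancel₀ h0)
    have h' : a ∈ _ := (h ▸ E.star_univ 3 0).symm ▸ Set.mem_univ a
    rw [E.star_union] at h'
    exact h'.resolve_left hx

/-- The finite elements of `*ℝ`: those `x` with `|x| < n` in `*ℝ` for some standard natural
number `n`. -/
def realFin {M : Type u} (E : NonstandardExtension.{u, 0, w} M ℝ) : Set E.Snd :=
  {x | ∃ n : ℕ, E.relSnd (· < ·) (E.mapSnd (fun r => |r|) x) (E.coeSnd (n : ℝ))}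

/-- Given `h : M → ℝ`, the set of elements `x` of `*M` whose (extended) height `h x ∈ *ℝ` is
finite. -/
def heightFin {M : Type u} (E : NonstandardExtension.{u, 0, w} M ℝ) (h : M → ℝ) : Set E.Fst :=
  {x | E.mapFstSnd h x ∈ E.realFin}

end NonstandardExtension

/-! An operation keeps `*K` elements of finite height finite as soon as the height of its value over
`K` is bounded in terms of the heights of its arguments. Such a bound is an inclusion between
standard sets `{h < k}`, and the star map is monotone (`starFst_mem_heightFin_of_bound`); no
saturation is needed. For the field operations the bounds are h(x+y) ≤ log 2 + h(x) + h(y), h(xy) ≤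
h(x) + h(y) and h(-x) = h(x⁻¹) = h(x). For algebraic closedness, choose a root of every monic
polynomial of degree n+1 over `K` as a function of its coefficients. The extended function gives
roots in `*K`, and `absLogHeight₁_root_le`, whose constant log(n+1) depends on the degree alone,
keeps them in L. A polynomial over L has a standard degree, so this suffices. Each inequality is
proved in one number field containing all the elements involved. That requires the absolute height
to be independent of the field (`mulHeight₁_algebraMap`, `absLogHeight₁_coe`). -/

namespace NumberField

/-! ### Heights under extension of number fields. -/

open Height AdmissibleAbsValues Module

variable {k K : Type*} [Field k] [NumberField k] [Field K] [NumberField K]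

theorem InfinitePlace.prod_pow_mult_eq_prod_embeddings {M : Type*} [CommMonoid M]
    (f : InfinitePlace K → M) :
    ∏ w : InfinitePlace K, f w ^ w.mult = ∏ φ : K →+* ℂ, f (InfinitePlace.mk φ) := by
  classical
  rw [← Finset.prod_fiberwise Finset.univ InfinitePlace.mk fun φ : K →+* ℂ => f (.mk φ)]
  refine Finset.prod_congr rfl fun w _ => ?_
  rw [← InfinitePlace.card_filter_mk_eq w, ← Finset.prod_const]
  exact Finset.prod_congr rfl fun φ hφ => by rw [(Finset.mem_filter.mp hφ).2]

/-- Once ℂ is a `k`-algebra through `ψ`, these embeddings are exactly the `k`-algebra maps from `K`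
to ℂ. -/
theorem card_embeddings_comp_algebraMap_eq [Algebra k K] (ψ : k →+* ℂ)
    [DecidablePred fun φ : K →+* ℂ => φ.comp (algebraMap k K) = ψ] :
    (Finset.univ.filter fun φ : K →+* ℂ => φ.comp (algebraMap k K) = ψ).card = finrank k K := by
  let _ := ψ.toAlgebra
  rw [← AlgHom.card k K ℂ, ← Fintype.card_subtype]
  refine Fintype.card_congr
    { toFun := fun φ => { φ.1 with commutes' := fun r => RingHom.congr_fun φ.2 r }
      invFun := fun φ => ⟨φ.toRingHom, φ.comp_algebraMap⟩
      left_inv := fun _ => rfl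
      right_inv := fun _ => rfl }

/-- Replace places by complex embeddings and group those of `K` by their restriction to `k`; every
fibre has `[K : k]` elements. -/
theorem InfinitePlace.prod_comap_pow_mult {M : Type*} [CommMonoid M] [Algebra k K]
    (f : InfinitePlace k → M) :
    ∏ w : InfinitePlace K, f (w.comap (algebraMap k K)) ^ w.mult =
      (∏ v : InfinitePlace k, f v ^ v.mult) ^ finrank k K := by
  classical
  rw [prod_pow_mult_eq_prod_embeddings f,
    prod_pow_mult_eq_prod_embeddings fun w : InfinitePlace K => f (w.comap (algebraMap k K)),
    ← Finset.prod_fiberwise Finset.univ fun φ : K →+* ℂ => φ.comp (algebraMap k K),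
    ← Finset.prod_pow]
  refine Finset.prod_congr rfl fun ψ _ => ?_
  rw [← card_embeddings_comp_algebraMap_eq (K := K) ψ, ← Finset.prod_const]
  refine Finset.prod_congr rfl fun φ hφ => ?_
  rw [InfinitePlace.comap_mk, (Finset.mem_filter.mp hφ).2]

/-- For integral coordinates the finite places together contribute the inverse norm of the ideal
they generate, leaving only the archimedean part. -/
theorem mulHeight_mul_absNorm {ι : Type*} [Finite ι] {x : ι → 𝓞 K} (hx : x ≠ 0) :
    mulHeight (fun i => (x i : K)) * (Ideal.span (Set.range x)).absNorm =
      ∏ v : InfinitePlace K, (⨆ i, v (x i)) ^ v.mult := by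
  have hx' : (fun i => (x i : K)) ≠ 0 := by
    obtain ⟨i, hi⟩ := Function.ne_iff.mp hx
    exact Function.ne_iff.mpr ⟨i, by simpa using hi⟩
  rw [mulHeight_eq hx', mul_assoc, mul_comm (finprod _),
    absNorm_mul_finprod_finitePlace_eq_one hx, mul_one]

/-- Both the archimedean product and the norm of the extended ideal are raised to the power `[K :
k]`, so no analysis of finite places above a given one is needed. -/
theorem mulHeight_algebraMap_ringOfIntegers [Algebra k K] {ι : Type*} [Finite ι]
    {x : ι → 𝓞 k} (hx : x ≠ 0) :
    mulHeight (fun i => algebraMap k K (x i)) = mulHeight (fun i => (x i : k)) ^ finrank k K := by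
  let y : ι → 𝓞 K := fun i => algebraMap (𝓞 k) (𝓞 K) (x i)
  have hy : y ≠ 0 := by
    obtain ⟨i, hi⟩ := Function.ne_iff.mp hx
    exact Function.ne_iff.mpr ⟨i, by simpa [y] using hi⟩
  have hyx : (fun i => (y i : K)) = fun i => algebraMap k K (x i) := rfl
  have hspan : Ideal.span (Set.range y) =
      (Ideal.span (Set.range x)).map (algebraMap (𝓞 k) (𝓞 K)) := by
    rw [Ideal.map_span, ← Set.range_comp]
    rfl
  have h1 := mulHeight_mul_absNorm hy
  have h2 := mulHeight_mul_absNorm hx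
  have hN : (((Ideal.span (Set.range x)).absNorm : ℝ)) ≠ 0 := by
    rw [Nat.cast_ne_zero, Ne, Ideal.absNorm_eq_zero_iff, Ideal.span_eq_bot]
    contrapose! hx
    exact funext fun i => hx _ ⟨i, rfl⟩
  have h3 := InfinitePlace.prod_comap_pow_mult (K := K) fun v : InfinitePlace k => ⨆ i, v (x i)
  have h4 : ∏ w : InfinitePlace K, (⨆ i, w.comap (algebraMap k K) (x i)) ^ w.mult =
      ∏ w : InfinitePlace K, (⨆ i, w (y i)) ^ w.mult := rfl
  rw [← h2, h4, ← h1, hyx, hspan, Ideal.absNorm_algebraMap,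
    ← IsFractionRing.finrank_eq (𝓞 k) k (𝓞 K) K, mul_pow, Nat.cast_pow] at h3
  exact mul_right_cancel₀ (pow_ne_zero _ hN) h3

/-- The multiplicative height relative to a number field `K` of an element of a subfield `k` is the
`[K : k]`-th power of its height relative to `k`. -/
theorem mulHeight₁_algebraMap [Algebra k K] (x : k) :
    mulHeight₁ (algebraMap k K x) = mulHeight₁ x ^ finrank k K := by
  -- The height of a fraction is that of the pair (numerator, denominator), which reduces to
  -- integral tuples.
  obtain ⟨a, b, hb, rfl⟩ := IsFractionRing.div_surjective (A := 𝓞 k) x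
  have hb' : b ≠ 0 := nonZeroDivisors.ne_zero hb
  have h := mulHeight_algebraMap_ringOfIntegers (K := K) (x := ![a, b])
    (Function.ne_iff.mpr ⟨1, hb'⟩)
  have e1 : (fun i => algebraMap k K (![a, b] i : 𝓞 k)) =
      ![algebraMap k K a, algebraMap k K b] := by
    ext i; fin_cases i <;> rfl
  have e2 : (fun i => ((![a, b] i : 𝓞 k) : k)) = ![(a : k), (b : k)] := by
    ext i; fin_cases i <;> rfl
  rw [e1, e2] at h
  rw [map_div₀, mulHeight₁_div_eq_mulHeight, mulHeight₁_div_eq_mulHeight]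
  exact h

theorem logHeight₁_algebraMap [Algebra k K] (x : k) :
    logHeight₁ (algebraMap k K x) = finrank k K * logHeight₁ x := by
  rw [logHeight₁_eq_log_mulHeight₁, mulHeight₁_algebraMap, Real.log_pow,
    logHeight₁_eq_log_mulHeight₁]

theorem logHeight₁_map_div_finrank (f : k →+* K) (x : k) :
    logHeight₁ (f x) / finrank ℚ K = logHeight₁ x / finrank ℚ k := by
  let _ := f.toAlgebra
  have hk : (finrank ℚ k : ℝ) ≠ 0 := Nat.cast_ne_zero.mpr finrank_pos.ne'
  have : Module.Finite k K := Module.Finite.of_restrictScalars_finite ℚ k K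
  have hK : (finrank k K : ℝ) ≠ 0 := Nat.cast_ne_zero.mpr finrank_pos.ne'
  have h := logHeight₁_algebraMap (K := K) x
  rw [← finrank_mul_finrank ℚ k K, Nat.cast_mul]
  change logHeight₁ (algebraMap k K x) / _ = _
  rw [h]
  field_simp

/-! ### The absolute height and its independence of the field. -/

section Absolute

variable {L : Type*} [Field L] [CharZero L]

/-- The absolute logarithmic height can be computed in any number field containing the given
element. -/
theorem absLogHeight₁_coe (F : IntermediateField ℚ L) [NumberField F] (x : F) :
    absLogHeight₁ (x : L) = logHeight₁ x / finrank ℚ F := by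
  have hx : IsIntegral ℚ (x : L) := (IsIntegral.of_finite ℚ x).map F.val
  have : FiniteDimensional ℚ (IntermediateField.adjoin ℚ {(x : L)}) :=
    IntermediateField.adjoin.finiteDimensional hx
  have : NumberField (IntermediateField.adjoin ℚ {(x : L)}) := {}
  have hle : IntermediateField.adjoin ℚ {(x : L)} ≤ F := by simp
  have h := logHeight₁_map_div_finrank (IntermediateField.inclusion hle).toRingHom
    (IntermediateField.AdjoinSimple.gen ℚ (x : L))
  have hgen : (IntermediateField.inclusion hle).toRingHom
    (IntermediateField.AdjoinSimple.gen ℚ (x : L)) = x := rfl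
  rw [hgen] at h
  rw [absLogHeight₁, absMulHeight₁, dif_pos hx, Real.log_rpow (mulHeight₁_pos _), h,
    logHeight₁_eq_log_mulHeight₁, div_eq_inv_mul]

theorem absLogHeight₁_nonneg (x : L) : 0 ≤ absLogHeight₁ x := by
  rw [absLogHeight₁, absMulHeight₁]
  split_ifs with hx
  · have : FiniteDimensional ℚ (IntermediateField.adjoin ℚ {x}) :=
      IntermediateField.adjoin.finiteDimensional hx
    have : NumberField (IntermediateField.adjoin ℚ {x}) := {}
    exact Real.log_nonneg (Real.one_le_rpow (one_le_mulHeight₁ _) (by positivity))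
  -- Default value of the height at elements that are not algebraic.
  · simp

variable [Algebra.IsAlgebraic ℚ L]

theorem exists_numberField_mem {s : Set L} (hs : s.Finite) :
    ∃ F : IntermediateField ℚ L, NumberField F ∧ s ⊆ F := by
  have : Finite s := hs
  have : FiniteDimensional ℚ (IntermediateField.adjoin ℚ s) :=
    IntermediateField.finiteDimensional_adjoin fun x _ => Algebra.IsIntegral.isIntegral x
  exact ⟨_, {}, IntermediateField.subset_adjoin ℚ s⟩

end Absolute

end NumberField

/-! ### Heights of roots of monic polynomials. -/

namespace Height

open AdmissibleAbsValues

variable {K : Type*} [Field K]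

/-- If |x| > 1, cancel |x|^n. The constant is left free because the archimedean and nonarchimedean
cases use different ones. -/
theorem max_abv_one_le_of_pow_le (v : AbsoluteValue K ℝ) {n : ℕ} {x : K} {C : ℝ}
    (hC : 1 ≤ C) (h : 1 ≤ v x → v (x ^ (n + 1)) ≤ C * v x ^ n) : max (v x) 1 ≤ C := by
  refine max_le ?_ hC
  rcases le_or_gt (v x) 1 with hx | hx
  · exact hx.trans hC
  · have h1 := h hx.le
    rw [map_pow, pow_succ'] at h1
    exact le_of_mul_le_mul_right h1 (by positivity)

/-- All factors of the product are at least 1, so it dominates each one. A product, unlike a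
maximum, multiplies over the places into a product of heights. -/
theorem abv_mul_pow_le (v : AbsoluteValue K ℝ) {n : ℕ} (a : Fin (n + 1) → K)
    {x : K} (hx : 1 ≤ v x) (i : Fin (n + 1)) :
    v (a i * x ^ (i : ℕ)) ≤ (∏ i, max (v (a i)) 1) * v x ^ n := by
  rw [map_mul, map_pow]
  gcongr
  · exact Finset.le_prod_max_one (Finset.mem_univ i) fun i => v (a i)
  · exact Nat.lt_succ_iff.mp i.2

/-- The triangle inequality costs a factor n+1, the number of terms; in the ultrametric version
below it disappears. -/
theorem max_abv_root_one_le (v : AbsoluteValue K ℝ) {n : ℕ} (a : Fin (n + 1) → K)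
    {x : K} (h : x ^ (n + 1) = ∑ i, a i * x ^ (i : ℕ)) :
    max (v x) 1 ≤ (n + 1 : ℕ) * ∏ i, max (v (a i)) 1 := by
  have hP : 1 ≤ ∏ i, max (v (a i)) 1 := Finset.univ.one_le_prod fun _ _ => le_max_right ..
  refine max_abv_one_le_of_pow_le (n := n) v
    (one_le_mul_of_one_le_of_one_le (by simp) hP) fun hx => ?_
  rw [h]
  refine (v.sum_le _ _).trans ?_
  refine (Finset.sum_le_card_nsmul _ _ _ fun i _ => abv_mul_pow_le v a hx i).trans ?_
  simp [mul_assoc]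

theorem max_abv_root_one_le_of_isNonarchimedean {v : AbsoluteValue K ℝ}
    (hv : IsNonarchimedean v) {n : ℕ} (a : Fin (n + 1) → K)
    {x : K} (h : x ^ (n + 1) = ∑ i, a i * x ^ (i : ℕ)) :
    max (v x) 1 ≤ ∏ i, max (v (a i)) 1 := by
  have hP : 1 ≤ ∏ i, max (v (a i)) 1 := Finset.univ.one_le_prod fun _ _ => le_max_right ..
  refine max_abv_one_le_of_pow_le (n := n) v hP fun hx => ?_
  rw [h]
  exact (hv.apply_sum_le_sup Finset.univ_nonempty).trans
    (Finset.sup'_le _ _ fun i _ => abv_mul_pow_le v a hx i)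

variable [AdmissibleAbsValues K]

open Finset Multiset in
/-- The height of a root of a monic polynomial is bounded in terms of the heights of the
coefficients. -/
theorem mulHeight₁_root_le {n : ℕ} (a : Fin (n + 1) → K) {x : K}
    (h : x ^ (n + 1) = ∑ i, a i * x ^ (i : ℕ)) :
    mulHeight₁ x ≤ (n + 1 : ℕ) ^ totalWeight K * ∏ i, mulHeight₁ (a i) := by
  simp only [mulHeight₁_eq, totalWeight]
  -- The power of n+1 is spread out as one factor per archimedean absolute value, so that the local
  -- bounds can be multiplied place by place.
  rw [prod_mul_distrib, ← prod_replicate, ← map_const, ← finprod_prod_comm _ _ (by fun_prop),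
    ← prod_map_prod, ← mul_assoc, ← prod_map_mul]
  simp only [Function.const_apply]
  gcongr
  · exact finprod_nonneg fun _ => by positivity
  · exact prod_map_nonneg fun _ h => by positivity
  · exact prod_map_le_prod_map₀ _ _ (fun _ _ => by positivity) fun _ _ => max_abv_root_one_le _ a h
  · exact finprod_le_finprod (by fun_prop) (fun _ => by grind) (by fun_prop) <|
      fun v => max_abv_root_one_le_of_isNonarchimedean (isNonarchimedean _ v.prop) a h

theorem logHeight₁_root_le {n : ℕ} (a : Fin (n + 1) → K) {x : K}
    (h : x ^ (n + 1) = ∑ i, a i * x ^ (i : ℕ)) :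
    logHeight₁ x ≤ totalWeight K * Real.log (n + 1 : ℕ) + ∑ i, logHeight₁ (a i) := by
  simp only [logHeight₁_eq_log_mulHeight₁]
  rw [← Real.log_prod fun _ _ => mulHeight₁_ne_zero _, ← Real.log_pow,
    ← Real.log_mul (by positivity) (Finset.prod_ne_zero_iff.mpr fun _ _ => mulHeight₁_ne_zero _)]
  exact Real.log_le_log (mulHeight₁_pos _) (mulHeight₁_root_le a h)

end Height

/-! ### Inequalities for the absolute height. -/

namespace NumberField

open Height Module

variable {L : Type*} [Field L] [CharZero L] [Algebra.IsAlgebraic ℚ L]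

/-- The total archimedean weight of `F` is `[F : ℚ]`, so dividing by the degree leaves a constant
that does not depend on `F`. -/
theorem absLogHeight₁_root_le {n : ℕ} (a : Fin (n + 1) → L) {x : L}
    (h : x ^ (n + 1) = ∑ i, a i * x ^ (i : ℕ)) :
    absLogHeight₁ x ≤ Real.log (n + 1 : ℕ) + ∑ i, absLogHeight₁ (a i) := by
  obtain ⟨F, hF, hs⟩ := exists_numberField_mem ((Set.finite_range a).insert x)
  lift x to F using hs (Set.mem_insert _ _)
  have ha : ∀ i, a i ∈ F := fun i => hs (Set.mem_insert_of_mem _ ⟨i, rfl⟩)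
  lift a to Fin (n + 1) → F using ha
  have hF0 : (0 : ℝ) < finrank ℚ F := Nat.cast_pos.mpr finrank_pos
  have h' := logHeight₁_root_le a (x := x) (Subtype.ext (by simpa using h))
  simp only [absLogHeight₁_coe]
  rw [totalWeight_eq_finrank] at h'
  rw [← Finset.sum_div, div_le_iff₀ hF0, add_mul, div_mul_cancel₀ _ hF0.ne']
  linarith

theorem absLogHeight₁_add_le (x y : L) :
    absLogHeight₁ (x + y) ≤ Real.log 2 + absLogHeight₁ x + absLogHeight₁ y := by
  obtain ⟨F, hF, hs⟩ := exists_numberField_mem (Set.toFinite {x, y})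
  lift x to F using hs (by simp)
  lift y to F using hs (by simp)
  have hF0 : (0 : ℝ) < finrank ℚ F := Nat.cast_pos.mpr finrank_pos
  have h := logHeight₁_add_le x y
  rw [totalWeight_eq_finrank] at h
  rw [← F.coe_add]
  simp only [absLogHeight₁_coe]
  rw [add_assoc, ← add_div, div_le_iff₀ hF0, add_mul, div_mul_cancel₀ _ hF0.ne']
  linarith

theorem absLogHeight₁_mul_le (x y : L) :
    absLogHeight₁ (x * y) ≤ absLogHeight₁ x + absLogHeight₁ y := by
  obtain ⟨F, hF, hs⟩ := exists_numberField_mem (Set.toFinite {x, y})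
  lift x to F using hs (by simp)
  lift y to F using hs (by simp)
  rw [← F.coe_mul]
  simp only [absLogHeight₁_coe]
  rw [← add_div]
  gcongr
  exact logHeight₁_mul_le x y

theorem absLogHeight₁_neg (x : L) : absLogHeight₁ (-x) = absLogHeight₁ x := by
  obtain ⟨F, hF, hs⟩ := exists_numberField_mem (Set.toFinite {x})
  lift x to F using hs (by simp)
  rw [← F.coe_neg]
  simp only [absLogHeight₁_coe, logHeight₁_neg]

theorem absLogHeight₁_inv (x : L) : absLogHeight₁ x⁻¹ = absLogHeight₁ x := by
  obtain ⟨F, hF, hs⟩ := exists_numberField_mem (Set.toFinite {x})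
  lift x to F using hs (by simp)
  rw [← F.coe_inv]
  simp only [absLogHeight₁_coe, logHeight₁_inv]

end NumberField

/-! ### Transfer of height bounds to the nonstandard extension. -/

namespace NonstandardExtension

section RingHom

variable {M : Type u} {N : Type v} (E : NonstandardExtension.{u, v, w} M N)

/-- Evaluation of the extension of a function at a given point, as a ring homomorphism. -/
noncomputable def starFstHom [Field M] {m n : ℕ} (a : (Fin m → E.Fst) × (Fin n → E.Snd)) :
    ((Fin m → M) × (Fin n → N) → M) →+* E.Fst where
  toFun f := E.starFst f a
  map_one' := (E.coeFst_eq a 1).symm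
  map_zero' := (E.coeFst_eq a 0).symm
  map_mul' f g := (E.mapFst₂_starFst a (· * ·) f g).symm
  map_add' f g := (E.mapFst₂_starFst a (· + ·) f g).symm

end RingHom

variable {M : Type u} (E : NonstandardExtension.{u, 0, w} M ℝ) (h : M → ℝ)

/-- Turns finiteness into membership in the star of a standard set, where `star_mono` applies; the
standard bound `k` stays outside the star. -/
theorem starFst_mem_heightFin {m n : ℕ} (f : (Fin m → M) × (Fin n → ℝ) → M)
    (a : (Fin m → E.Fst) × (Fin n → E.Snd)) :
    E.starFst f a ∈ E.heightFin h ↔ ∃ k : ℕ, a ∈ E.star {p | |h (f p)| < k} := by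
  refine exists_congr fun k => ?_
  have hc := E.star_comp (m := m) (n := n) (Fin.elim0 : Fin 0 → _)
    ![fun p => |h (f p)|, fun _ => (k : ℝ)] {p | p.2 0 < p.2 1}
  have h0 : E.mapFstSnd h (E.starFst f a) = E.starSnd (fun p => h (f p)) a := by
    refine Eq.trans ?_ (E.starSnd_comp (fun p : (Fin 1 → M) × (Fin 0 → ℝ) => h (p.1 0))
      ![f] ![] a).symm
    rw [mapFstSnd]
    congr 2
    · funext i; fin_cases i; rfl
    · exact Subsingleton.elim _ _
  have h1 : E.mapSnd (fun r => |r|) (E.mapFstSnd h (E.starFst f a)) =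
      E.starSnd (fun p => |h (f p)|) a := by
    rw [h0]
    -- Exchanging the sorts makes the ℝ-valued function one with values in the first sort.
    exact E.swap.mapFst_starFst a.swap (fun r => |r|) (fun p => h (f p.swap))
  have h2 : E.coeSnd (k : ℝ) = E.starSnd (fun _ => (k : ℝ)) a :=
    E.swap.coeFst_eq a.swap (k : ℝ)
  have h3 : a ∈ E.star {p | |h (f p)| < k} ↔
      (fun i => E.starFst ((Fin.elim0 : Fin 0 → _) i) a, fun j => E.starSnd
        ((![fun p => |h (f p)|, fun _ => (k : ℝ)] :
          Fin 2 → (Fin m → M) × (Fin n → ℝ) → ℝ) j) a) ∈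
        E.star {p : (Fin 0 → M) × (Fin 2 → ℝ) | p.2 0 < p.2 1} :=
    iff_of_eq (congrArg (a ∈ ·) hc)
  rw [h3, relSnd, h1, h2]
  refine iff_of_eq (congrArg (· ∈ _) (Prod.ext (Subsingleton.elim _ _) ?_))
  funext j
  fin_cases j <;> rfl

/-- A function whose height is bounded in terms of the heights of its arguments preserves
finiteness of heights. -/
theorem starFst_mem_heightFin_of_bound {m : ℕ} (f : (Fin m → M) → M)
    (hf : ∀ B : ℕ, ∃ C : ℕ, ∀ x : Fin m → M, (∀ i, |h (x i)| < B) → |h (f x)| < C)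
    {b : Fin m → E.Fst} (hb : ∀ i, b i ∈ E.heightFin h) :
    E.starFst (fun p : (Fin m → M) × (Fin 0 → ℝ) => f p.1) (b, ![]) ∈ E.heightFin h := by
  have hb' : ∀ i, ∃ k : ℕ, (b, ![]) ∈
      E.star {p : (Fin m → M) × (Fin 0 → ℝ) | |h (p.1 i)| < k} := fun i => by
    rw [← E.starFst_mem_heightFin h fun p : (Fin m → M) × (Fin 0 → ℝ) => p.1 i, starFst_proj]
    exact hb i
  choose k hk using hb'
  -- The sum is a common bound for the finitely many arguments.
  obtain ⟨C, hC⟩ := hf (∑ i, k i)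
  rw [starFst_mem_heightFin]
  refine ⟨C, E.star_mono (A := {p | ∀ i, |h (p.1 i)| < (∑ i, k i : ℕ)})
    (fun p hp => hC p.1 hp) ?_⟩
  rw [star_forall]
  refine fun i => E.star_mono (fun p hp => ?_) (hk i)
  exact lt_of_lt_of_le (show |h (p.1 i)| < k i from hp)
    (Nat.cast_le.mpr (Finset.single_le_sum (fun _ _ => Nat.zero_le _) (Finset.mem_univ i)))

/-- The elements of finite height form a subfield, if the heights of sums, products, negatives and
inverses are bounded in terms of the heights of the arguments. -/
noncomputable def heightFinSubfield {K : Type u} [Field K] (E : NonstandardExtension.{u, 0, w} K ℝ)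
    (h : K → ℝ) (c : ℝ) (hadd : ∀ x y, |h (x + y)| ≤ c + |h x| + |h y|)
    (hmul : ∀ x y, |h (x * y)| ≤ |h x| + |h y|) (hneg : ∀ x, h (-x) = h x)
    (hinv : ∀ x, h x⁻¹ = h x) : Subfield E.Fst where
  carrier := E.heightFin h
  mul_mem' {x y} hx hy := by
    -- The product in `*K` is by definition the extended multiplication evaluated at `![x, y]`.
    refine E.starFst_mem_heightFin_of_bound h (fun p => p 0 * p 1)
      (fun B => ⟨B + B, fun p hp => ?_⟩) (b := ![x, y]) (Fin.forall_fin_two.mpr ⟨hx, hy⟩)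
    push_cast
    linarith [hmul (p 0) (p 1), hp 0, hp 1]
  add_mem' {x y} hx hy := by
    refine E.starFst_mem_heightFin_of_bound h (fun p => p 0 + p 1)
      (fun B => ⟨⌈c⌉₊ + B + B, fun p hp => ?_⟩) (b := ![x, y]) (Fin.forall_fin_two.mpr ⟨hx, hy⟩)
    push_cast
    linarith [hadd (p 0) (p 1), hp 0, hp 1, Nat.le_ceil c]
  neg_mem' {x} hx :=
    E.starFst_mem_heightFin_of_bound h (fun p => - p 0)
      (fun B => ⟨B, fun p hp => by rw [hneg]; exact hp 0⟩) (b := ![x]) (Fin.forall_fin_one.mpr hx)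
  inv_mem' x hx :=
    E.starFst_mem_heightFin_of_bound h (fun p => (p 0)⁻¹)
      (fun B => ⟨B, fun p hp => by rw [hinv]; exact hp 0⟩) (b := ![x]) (Fin.forall_fin_one.mpr hx)
  one_mem' := by
    obtain ⟨k, hk⟩ := exists_nat_gt |h 1|
    -- A constant is a function of no arguments, so one bound serves every `B`.
    exact E.starFst_mem_heightFin_of_bound h (fun _ : Fin 0 → K => 1) (fun _ => ⟨k, fun _ _ => hk⟩)
      (b := Fin.elim0) fun i => i.elim0
  zero_mem' := by
    obtain ⟨k, hk⟩ := exists_nat_gt |h 0|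
    exact E.starFst_mem_heightFin_of_bound h (fun _ : Fin 0 → K => 0) (fun _ => ⟨k, fun _ _ => hk⟩)
      (b := Fin.elim0) fun i => i.elim0

/-- Stated through the tuple of coefficients so that a choice of roots is a function on `K ^ (n +
1)`, which has an extension. -/
theorem _root_.IsAlgClosed.exists_pow_eq_sum {K : Type*} [Field K] [IsAlgClosed K] {n : ℕ}
    (a : Fin (n + 1) → K) : ∃ x : K, x ^ (n + 1) = ∑ i, a i * x ^ (i : ℕ) := by
  open Polynomial in
  have hd : (∑ i : Fin (n + 1), C (a i) * X ^ (i : ℕ)).degree < ((n + 1 : ℕ) : WithBot ℕ) := by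
    refine (degree_sum_le _ _).trans_lt ?_
    rw [Finset.sup_lt_iff (WithBot.bot_lt_coe _)]
    exact fun i _ => (degree_C_mul_X_pow_le _ _).trans_lt (Nat.cast_lt.mpr i.2)
  have hd' : (X ^ (n + 1) - ∑ i : Fin (n + 1), C (a i) * X ^ (i : ℕ)).degree =
      ((n + 1 : ℕ) : WithBot ℕ) := by
    rw [degree_sub_eq_left_of_degree_lt, degree_X_pow]
    rwa [degree_X_pow]
  obtain ⟨x, hx⟩ := IsAlgClosed.exists_root _ (hd'.trans_ne (Nat.cast_ne_zero.mpr n.succ_ne_zero))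
  refine ⟨x, ?_⟩
  simpa [IsRoot, eval_finsetSum, sub_eq_zero] using hx

/-- If the heights of the roots of monic polynomials are bounded in terms of the heights of the
coefficients, every monic polynomial over a subfield consisting of the elements of finite height
has a root. -/
theorem isAlgClosed_of_coe_eq_heightFin {K : Type u} [Field K] [IsAlgClosed K]
    {E : NonstandardExtension.{u, 0, w} K ℝ} {h : K → ℝ} {L : Subfield E.Fst}
    (hL : (L : Set E.Fst) = E.heightFin h) (c : ℕ → ℝ)
    (hroot : ∀ (n : ℕ) (a : Fin (n + 1) → K) (x : K), x ^ (n + 1) = ∑ i, a i * x ^ (i : ℕ) →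
      |h x| ≤ c n + ∑ i, |h (a i)|) : IsAlgClosed L := by
  refine IsAlgClosed.of_exists_root _ fun p hp hirr => ?_
  obtain ⟨n, hn⟩ : ∃ n, p.natDegree = n + 1 :=
    Nat.exists_eq_add_one_of_ne_zero hirr.natDegree_pos.ne'
  -- The sign moves the lower-order terms to the other side of the equation.
  let b : Fin (n + 1) → E.Fst := fun i => -(p.coeff i : E.Fst)
  choose r hr using IsAlgClosed.exists_pow_eq_sum (K := K) (n := n)
  let F := E.starFstHom (N := ℝ) (m := n + 1) (n := 0) (b, ![])
  let R : (Fin (n + 1) → K) × (Fin 0 → ℝ) → K := fun p => r p.1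
  have hmem : F R ∈ L := by
    rw [← SetLike.mem_coe, hL]
    refine E.starFst_mem_heightFin_of_bound h r
      -- The final 1 makes the bound strict.
      (fun B => ⟨⌈c n⌉₊ + (n + 1) * B + 1, fun x hx => ?_⟩) fun i => ?_
    · have h1 := hroot n x _ (hr x)
      have h2 : ∑ i, |h (x i)| ≤ (n + 1) * B :=
        (Finset.sum_le_card_nsmul _ _ _ fun i _ => (hx i).le).trans (by simp)
      push_cast
      linarith [Nat.le_ceil (c n)]
    · rw [← hL]
      exact L.neg_mem (p.coeff i).2
  have heq : F R ^ (n + 1) = ∑ i, b i * F R ^ (i : ℕ) := by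
    -- The root equation holds identically in the ring of functions on `K ^ (n + 1)`; the evaluation
    -- homomorphism `F` carries it to `*K`, sending the coordinate functions to `b i`.
    have h1 : R ^ (n + 1) = ∑ i : Fin (n + 1), (fun p => p.1 i) * R ^ (i : ℕ) := by
      funext q
      simpa using hr q.1
    have h2 : ∀ i, F (fun p => p.1 i) = b i := fun i => E.starFst_proj i _
    rw [← map_pow, h1]
    simp only [map_sum, map_mul, map_pow, h2]
  refine ⟨⟨F R, hmem⟩, Subtype.ext ?_⟩
  have hlead : p.coeff (n + 1) = 1 := hn ▸ hp.coeff_natDegree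
  rw [Polynomial.eval_eq_sum_range, hn, Finset.sum_range_succ, hlead,
    ← Fin.sum_univ_eq_sum_range (fun i => p.coeff i * (⟨F R, hmem⟩ : L) ^ i)]
  simp [heq, b]

end NonstandardExtension

theorem lemma3p4 (E : NonstandardExtension.{0, 0, w} (AlgebraicClosure ℚ) ℝ) :
    ∃ L : Subfield E.Fst,
      (L : Set E.Fst) = E.heightFin NumberField.absLogHeight₁ ∧ IsAlgClosed L := by
  have : Algebra.IsAlgebraic ℚ (AlgebraicClosure ℚ) := by
    -- Algebraicity is needed for the ℚ-algebra structure coming from characteristic zero, which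
    -- must be identified with that of the algebraic closure.
    rw [Subsingleton.elim (DivisionRing.toRatAlgebra : Algebra ℚ (AlgebraicClosure ℚ))
      (AlgebraicClosure.instAlgebra ℚ)]
    exact AlgebraicClosure.isAlgebraic ℚ
  have habs : ∀ x : AlgebraicClosure ℚ, |NumberField.absLogHeight₁ x| =
      NumberField.absLogHeight₁ x :=
    fun x => abs_of_nonneg (NumberField.absLogHeight₁_nonneg x)
  refine ⟨NonstandardExtension.heightFinSubfield E NumberField.absLogHeight₁ (Real.log 2)
    (by simpa only [habs] using NumberField.absLogHeight₁_add_le)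
    (by simpa only [habs] using NumberField.absLogHeight₁_mul_le)
    NumberField.absLogHeight₁_neg NumberField.absLogHeight₁_inv, rfl,
    NonstandardExtension.isAlgClosed_of_coe_eq_heightFin rfl
      (fun n => Real.log (n + 1 : ℕ)) fun n a x hx => ?_⟩
  simpa only [habs] using NumberField.absLogHeight₁_root_le a hx
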